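/- Let $\Sigma$ be an alphabet (an arbitrary set). **Trees.** A finite $\Sigma$-labelled rooted tree is, recursively, a finite set of pairs $(a,T)$ with $a\in\Sigma$ and $T$ a finite $\Sigma$-labelled rooted tree: the pair $(a,T)$ is a child of the root, joined to it by an $a$-labelled edge and carrying the subtree $T$ (so isomorphic trees are equal). A tree is *pointed* if one of its vertices is distinguished as its *point*. On possibly pointed trees, define recursively $T_1\le T_2$ iff (a) if the root of $T_2$ is the point of $T_2$, then the root of $T_1$ is the point of $T_1$, and (b) for each child subtree $S_2$ of the root of $T_2$, attached by an edge labelled $a$, there is a child subtree $S_1$ of the root of $T_1$, attached by an edge labelled $a$, with $S_1\le S_2$. The *reduced form* of a tree is obtained by recursively replacing each child subtree of the root by its reduced form and then, for each label $a$, deleting all but the $\le$-minimal subtrees among the child subtrees attached to the root by $a$-labelled edges. A tree is *reduced* if it equals its reduced form; on reduced trees $\le$ is a partial order. Let $\mathcal R_\Sigma$ be the set of reduced pointed $\Sigma$-labelled finite rooted trees. **Operations.** For $T,S\in\mathcal R_\Sigma$, $T\mathbin{;}S$ is the reduced form of the tree obtained by identifying the point of $T$ with the root of $S$ (the new root is that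 of $T$, the new point is that of $S$), and $\mathsf D(T)$ is the reduced form of the tree obtained from $T$ by moving the point to the root. Both are extended to sets of trees elementwise. Write $\bullet$ for the one-vertex pointed tree and $\vec a$ for the tree with a single edge, labelled $a$, whose point is the child. For $K\subseteq\mathcal R_\Sigma$, let $\operatorname{maximal}(K)$ be the set of $\le$-maximal elements of $K$ and ${\downarrow}K=\{T\in\mathcal R_\Sigma\mid \exists S\in K,\ T\le S\}$. **Regular sets.** The standard tree interpretation of terms in the signature $\{;,+,{}^*,0,1,\mathsf D\}$ with variables in $\Sigma$ is defined by $[\![a]\!]=\{\vec a\}$ for $a\in\Sigma$, $[\![0]\!]=\emptyset$, $[\![1]\!]=\{\bullet\}$, $[\![s+t]\!]=\operatorname{maximal}([\![s]\!]\cup[\![t]\!])$, $[\![s;t]\!]=\operatorname{maximal}([\![s]\!]\mathbin{;}[\![t]\!])$, $[\![s^*]\!]=\operatorname{maximal}\bigl(\bigcup_{i\ge 0}[\![s]\!]^i\bigr)$, where $[\![s]\!]^0=\{\bullet\}$ and $[\![s]\!]^{i+1}=[\![s]\!]^i\mathbin{;}[\![s]\!]$, and $[\![\mathsf D(s)]\!]=\operatorname{maximal}(\mathsf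 D([\![s]\!]))$. A set of pointed trees is *regular* if it equals $[\![t]\!]$ for some such term $t$. **Proposition.** Let $L_1,L_2\subseteq\mathcal R_\Sigma$. If $L_1$ and $L_2$ are regular, then $$L_1\sqcap L_2:=\operatorname{maximal}({\downarrow}L_1\cap{\downarrow}L_2)$$ is regular. -/

import Mathlib

universe u

/-- One layer of a (possibly pointed) `A`-labelled rooted tree: a flag saying whether the root is
the point, and a finite set of pairs `(a, T)`, where `a` labels the edge from the root to a child
and `T` is the subtree rooted at that child. -/
def LTreeLayer (A : Type u) (X : Type u) : Type u := Bool × Finset (A × X)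

open Classical in
/-- The layer functor acts on the subtrees. -/
noncomputable instance LTreeLayer.instFunctor (A : Type u) : Functor (LTreeLayer A) where
  map f x := (x.1, x.2.image (fun p => (p.1, f p.2)))

open Classical in
/-- A layer is a quotient of a flag with a finite sequence of labelled subtrees, so that the
hereditarily finite sets of labelled pairs exist as the initial algebra `QPF.Fix`. -/
noncomputable instance LTreeLayer.instQPF (A : Type u) : QPF.{u, u, u} (LTreeLayer A) where
  P := ⟨Bool × (Σ n : ℕ, Fin n → A), fun x => ULift.{u} (Fin x.2.1)⟩
  abs p := (p.1.1, Finset.univ.image (fun i => (p.1.2.2 i, p.2 ⟨i⟩)))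
  repr x := ⟨(x.1, ⟨x.2.card, fun i => (x.2.equivFin.symm i).1.1⟩),
    fun i => (x.2.equivFin.symm i.down).1.2⟩
  abs_repr x := by
    obtain ⟨b, s⟩ := x
    refine Prod.ext rfl ?_
    ext q
    simp only [Finset.mem_image, Finset.mem_univ, true_and]
    constructor
    · rintro ⟨i, rfl⟩
      exact (s.equivFin.symm i).2
    · intro hq
      exact ⟨s.equivFin ⟨q, hq⟩, by simp⟩
  abs_map f p := by
    obtain ⟨⟨b, n, l⟩, g⟩ := p
    refine Prod.ext rfl ?_
    change Finset.univ.image _ = (Finset.univ.image _).image _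
    rw [Finset.image_image]
    rfl

/-- Finite `A`-labelled rooted trees in which every vertex carries a flag (`true` if this vertex
is the point). A tree *is* the flag of its root with the finite set of pairs
`(label, child subtree)`, so isomorphic trees are equal. The number of points is unrestricted here;
see `LTree.Unpointed` and `LTree.Pointed`. -/
def LTree (A : Type u) : Type u := QPF.Fix (LTreeLayer A)

namespace LTree

variable {A : Type u}

/-- The tree with the given root flag and the given set of labelled child subtrees. -/
noncomputable def mk (b : Bool) (s : Finset (A × LTree A)) : LTree A :=
  QPF.Fix.mk (F := LTreeLayer A) (b, s)

/-- Whether the root is (flagged as) the point. -/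
noncomputable def rootIsPoint (T : LTree A) : Bool := (QPF.Fix.dest (F := LTreeLayer A) T).1

/-- The set of pairs `(label, child subtree)` at the root. -/
noncomputable def children (T : LTree A) : Finset (A × LTree A) :=
  (QPF.Fix.dest (F := LTreeLayer A) T).2

/-- Structural recursion on trees. -/
noncomputable def fold {X : Type u} (g : Bool → Finset (A × X) → X) : LTree A → X :=
  QPF.Fix.rec (F := LTreeLayer A) (fun x => g x.1 x.2)

@[simp] theorem rootIsPoint_mk (b : Bool) (s : Finset (A × LTree A)) :
    (mk b s).rootIsPoint = b := by
  unfold rootIsPoint mk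
  exact congrArg Prod.fst (QPF.Fix.dest_mk (F := LTreeLayer A) (b, s))

@[simp] theorem children_mk (b : Bool) (s : Finset (A × LTree A)) : (mk b s).children = s := by
  unfold children mk
  exact congrArg Prod.snd (QPF.Fix.dest_mk (F := LTreeLayer A) (b, s))

theorem mk_eta (T : LTree A) : mk T.rootIsPoint T.children = T :=
  QPF.Fix.mk_dest (F := LTreeLayer A) T

open Classical in
theorem fold_mk {X : Type u} (g : Bool → Finset (A × X) → X) (b : Bool)
    (s : Finset (A × LTree A)) :
    fold g (mk b s) = g b (s.image (fun p => (p.1, fold g p.2))) :=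
  QPF.Fix.rec_eq (F := LTreeLayer A) (fun x => g x.1 x.2) (b, s)

open Classical in
theorem induction {p : LTree A → Prop}
    (h : ∀ b s, (∀ a T, (a, T) ∈ s → p T) → p (mk b s)) (T : LTree A) : p T := by
  refine QPF.Fix.ind (F := LTreeLayer A) p ?_ T
  rintro x ⟨y, hy⟩
  refine h x.1 x.2 fun a T hT => ?_
  rw [← hy] at hT
  obtain ⟨q, _, hq⟩ := Finset.mem_image.1 hT
  have hT2 : q.2.1 = T := congrArg Prod.snd hq
  exact hT2 ▸ q.2.2

/-- No vertex is the point. -/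
inductive Unpointed : LTree A → Prop
  | intro (T : LTree A) (root : T.rootIsPoint = false)
      (sub : ∀ a S, (a, S) ∈ T.children → Unpointed S) : Unpointed T

/-- Exactly one vertex is the point. -/
inductive Pointed : LTree A → Prop
  | root (T : LTree A) (root : T.rootIsPoint = true)
      (sub : ∀ a S, (a, S) ∈ T.children → Unpointed S) : Pointed T
  | child (T : LTree A) (root : T.rootIsPoint = false)
      (a : A) (S : LTree A) (mem : (a, S) ∈ T.children) (pointed : Pointed S)
      (others : ∀ b R, (b, R) ∈ T.children → (b, R) ≠ (a, S) → Unpointed R) : Pointed T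

/-- `T₁ ≤ T₂`, by recursion on `T₂`: if the root of `T₂` is the point of `T₂` then the root of `T₁`
is the point of `T₁`, and for each child of the root of `T₂` there is a child of the root of `T₁`
with the same edge label and a smaller or equivalent subtree; see `le_iff`. -/
noncomputable instance instLE : LE (LTree A) where
  le T₁ T₂ := fold (X := LTree A → Prop)
    (fun b s T => (b = true → T.rootIsPoint = true) ∧
      ∀ a P, (a, P) ∈ s → ∃ S, (a, S) ∈ T.children ∧ P S) T₂ T₁

theorem le_iff (T₁ T₂ : LTree A) :
    T₁ ≤ T₂ ↔ (T₂.rootIsPoint = true → T₁.rootIsPoint = true) ∧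
      ∀ a S₂, (a, S₂) ∈ T₂.children → ∃ S₁, (a, S₁) ∈ T₁.children ∧ S₁ ≤ S₂ := by
  classical
  let g : Bool → Finset (A × (LTree A → Prop)) → LTree A → Prop := fun b s T =>
    (b = true → T.rootIsPoint = true) ∧ ∀ a P, (a, P) ∈ s → ∃ S, (a, S) ∈ T.children ∧ P S
  have key : fold g T₂ = g T₂.rootIsPoint (T₂.children.image (fun p => (p.1, fold g p.2))) := by
    conv_lhs => rw [← mk_eta T₂]
    exact fold_mk g _ _
  change fold g T₂ T₁ ↔ _
  rw [key]
  refine and_congr Iff.rfl ⟨fun h a S hS => ?_, fun h a P hP => ?_⟩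
  · exact h a _ (Finset.mem_image.2 ⟨(a, S), hS, rfl⟩)
  · obtain ⟨⟨a', S⟩, hS, he⟩ := Finset.mem_image.1 hP
    obtain ⟨rfl, rfl⟩ := Prod.mk.inj he
    exact h _ S hS

open Classical in
/-- The reduced form: reduce all child subtrees of the root, then, for each label, keep only the
`≤`-minimal ones among the child subtrees with that label. -/
noncomputable def reduce : LTree A → LTree A :=
  fold (fun b s => mk b (s.filter (fun p => Minimal (fun S => (p.1, S) ∈ s) p.2)))

/-- The reduced pointed `A`-labelled finite rooted trees. -/
def reducedPointed (A : Type u) : Set (LTree A) := {T | T.Pointed ∧ T.reduce = T}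

open Classical in
/-- Identify the point of `T` with the root of `S`; the point is now that of `S`. -/
noncomputable def graft (T S : LTree A) : LTree A :=
  fold (fun b s => if b = true then mk S.rootIsPoint (s ∪ S.children) else mk false s) T

/-- Forget the point. -/
noncomputable def forget : LTree A → LTree A := fold (fun _ s => mk false s)

/-- Pointed tree concatenation. -/
noncomputable def concat (T S : LTree A) : LTree A := (graft T S).reduce

/-- The domain of a pointed tree: move the point to the root, then reduce. -/
noncomputable def domain (T : LTree A) : LTree A := (mk true T.forget.children).reduce

/-- The tree with a single vertex, which is the point. -/
noncomputable def trivial : LTree A := mk true ∅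

/-- The tree with a single edge, labelled `a`, whose point is the child vertex. -/
noncomputable def arrow (a : A) : LTree A := mk false {(a, trivial)}

/-- The `≤`-maximal elements of a set of trees. -/
def maximal (K : Set (LTree A)) : Set (LTree A) := {T | Maximal (fun S => S ∈ K) T}

/-- The downward closure, within the reduced pointed trees, of a set of trees. -/
def down (L : Set (LTree A)) : Set (LTree A) := {T | T ∈ reducedPointed A ∧ ∃ S ∈ L, T ≤ S}

/-- The intersection operation `L₁ ⊓ L₂ = maximal (↓L₁ ∩ ↓L₂)`. -/
def meet (L₁ L₂ : Set (LTree A)) : Set (LTree A) := maximal (down L₁ ∩ down L₂)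

/-- Iterated elementwise concatenation of a set of trees. -/
def setPow (L : Set (LTree A)) : ℕ → Set (LTree A)
  | 0 => {trivial}
  | n + 1 => Set.image2 concat (setPow L n) L

end LTree

/-- Terms in the signature of composition, union, reflexive transitive closure, `0`, `1` and
domain, with variables in `A`. -/
inductive KADTerm (A : Type u) : Type u
  | var (a : A)
  | zero
  | one
  | add (s t : KADTerm A)
  | comp (s t : KADTerm A)
  | star (s : KADTerm A)
  | dom (s : KADTerm A)

/-- The standard tree interpretation of a term. -/
def KADTerm.interp {A : Type u} : KADTerm A → Set (LTree A)
  | .var a => {LTree.arrow a}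
  | .zero => ∅
  | .one => {LTree.trivial}
  | .add s t => LTree.maximal (s.interp ∪ t.interp)
  | .comp s t => LTree.maximal (Set.image2 LTree.concat s.interp t.interp)
  | .star s => LTree.maximal (⋃ n : ℕ, LTree.setPow s.interp n)
  | .dom s => LTree.maximal (LTree.domain '' s.interp)

/-- A set of trees is regular if it is the standard tree interpretation of some term. -/
def LTree.IsRegular {A : Type u} (L : Set (LTree A)) : Prop := ∃ t : KADTerm A, t.interp = L

/-! A tree is read as a graph: its vertices are identified with the subtrees below them, edges lead
to children, and a term t denotes a relation `rel` on this graph, with `dom` acting as a test. The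
key equivalence (`mem_down_interp`) is that a reduced pointed tree T lies in ↓⟦t⟧ iff t relates the
root of T to its point (`Sat`). One direction holds because terms are positive, hence preserved by
homomorphisms and simulations (`sat_of_mem_interp`); for the other, a run of t traces out a tree of
⟦t⟧ that maps to T (`exists_maps_of_rel`). Since ⟦t⟧ is the set of maximal elements of ↓⟦t⟧
(`maximal_down_interp`), it suffices to find a term satisfied by exactly those pointed trees that
satisfy both given terms.

Such a term comes from a product of automata (`exists_sat_iff_and`). Terms compile to finite
automata whose transitions read an edge or perform a test, the tests remaining terms
(`recognizable_rel`), and Kleene elimination turns automata back into terms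
(`Recognizable.exists_rel`). In a pointed tree only one path leads from the root to the point, and
edges only go down, so accepting runs of the two automata traverse the same edges. They differ only
in their tests, which the product interleaves. -/

namespace LTree

variable {A : Type u}

/-! ### The preorder on trees -/

theorem le_refl' (T : LTree A) : T ≤ T := by
  induction T using LTree.induction with
  | h b s ih =>
    rw [le_iff]
    refine ⟨id, fun a S hS => ⟨S, hS, ih a S ?_⟩⟩
    simpa using hS

theorem le_trans' {T₁ T₂ T₃ : LTree A} (h₁ : T₁ ≤ T₂) (h₂ : T₂ ≤ T₃) : T₁ ≤ T₃ := by
  induction T₃ using LTree.induction generalizing T₁ T₂ with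
  | h b s ih =>
    rw [le_iff] at h₁ h₂ ⊢
    refine ⟨fun h => h₁.1 (h₂.1 h), fun a S hS => ?_⟩
    obtain ⟨S₂, hS₂, hle₂⟩ := h₂.2 a S hS
    obtain ⟨S₁, hS₁, hle₁⟩ := h₁.2 a S₂ hS₂
    exact ⟨S₁, hS₁, ih a S (by simpa using hS) hle₁ hle₂⟩

noncomputable instance instPreorder : Preorder (LTree A) where
  toLE := instLE
  le_refl := le_refl'
  le_trans _ _ _ := le_trans'

/-- Every child of a tree above T lies above a child of T with the same label, so by induction the
possible children form a finite set. -/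
theorem finite_Ici (T : LTree A) : {S | T ≤ S}.Finite := by
  classical
  induction T using LTree.induction with
  | h b s ih =>
    have hU : (⋃ p ∈ s, Prod.mk p.1 '' {S | p.2 ≤ S}).Finite :=
      s.finite_toSet.biUnion fun p hp => (ih p.1 p.2 hp).image _
    have hP : (Set.univ ×ˢ (hU.toFinset.powerset : Set (Finset (A × LTree A))) :
        Set (Bool × Finset (A × LTree A))).Finite := Set.finite_univ.prod (Finset.finite_toSet _)
    refine (hP.image fun q => mk q.1 q.2).subset fun S hS => ?_
    refine ⟨(S.rootIsPoint, S.children), ⟨Set.mem_univ _, ?_⟩, mk_eta S⟩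
    rw [Finset.mem_coe, Finset.mem_powerset]
    rintro ⟨a, S'⟩ hS'
    obtain ⟨T', hT', hle⟩ := ((le_iff _ _).1 hS).2 a S' hS'
    rw [children_mk] at hT'
    simp only [Set.Finite.mem_toFinset, Set.mem_iUnion]
    exact ⟨(a, T'), hT', S', hle, rfl⟩

/-- Up-sets of single trees are finite, so passing to `maximal` does not change the downward
closure. -/
theorem exists_le_mem_maximal {K : Set (LTree A)} {S : LTree A} (hS : S ∈ K) :
    ∃ S' ∈ maximal K, S ≤ S' := by
  have hfin : {R | R ∈ K ∧ S ≤ R}.Finite := (finite_Ici S).subset fun R hR => hR.2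
  obtain ⟨M, hSM, hM⟩ := hfin.exists_le_maximal (show S ∈ {R | R ∈ K ∧ S ≤ R} from ⟨hS, le_rfl⟩)
  exact ⟨M, ⟨hM.prop.1, fun R hR hMR => hM.2 ⟨hR, hSM.trans hMR⟩ hMR⟩, hSM⟩

/-! ### Reduction -/

open Classical in
theorem reduce_mk (b : Bool) (s : Finset (A × LTree A)) :
    reduce (mk b s) = mk b ((s.image fun p => (p.1, reduce p.2)).filter fun p =>
      Minimal (fun S => (p.1, S) ∈ s.image fun p => (p.1, reduce p.2)) p.2) :=
  fold_mk _ b s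

@[simp] theorem rootIsPoint_reduce (T : LTree A) : T.reduce.rootIsPoint = T.rootIsPoint := by
  rw [← mk_eta T, reduce_mk, rootIsPoint_mk, rootIsPoint_mk]

theorem mem_children_reduce {T : LTree A} {a : A} {S : LTree A} :
    (a, S) ∈ T.reduce.children ↔
      Minimal (fun S => ∃ R, (a, R) ∈ T.children ∧ R.reduce = S) S := by
  classical
  rw [← mk_eta T, reduce_mk, children_mk, children_mk]
  have key : ∀ S, (a, S) ∈ (T.children.image fun p => (p.1, reduce p.2)) ↔
      ∃ R, (a, R) ∈ T.children ∧ R.reduce = S := by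
    intro S
    simp only [Finset.mem_image, Prod.mk.injEq, Prod.exists]
    constructor
    · rintro ⟨_, R, hR, rfl, rfl⟩
      exact ⟨R, hR, rfl⟩
    · rintro ⟨R, hR, rfl⟩
      exact ⟨a, R, hR, rfl, rfl⟩
  rw [Finset.mem_filter]
  simp only [key]
  exact ⟨fun h => h.2, fun h => ⟨h.prop, h⟩⟩

/-- Together with `reduce_le`, this makes reduction invisible up to equivalence in the preorder. -/
theorem le_reduce (T : LTree A) : T ≤ T.reduce := by
  induction T using LTree.induction with
  | h b s ih =>
    rw [le_iff]
    refine ⟨fun h => by simpa using h, fun a S hS => ?_⟩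
    obtain ⟨R, hR, rfl⟩ := (mem_children_reduce.1 hS).prop
    exact ⟨R, hR, ih a R (by simpa using hR)⟩

theorem reduce_le (T : LTree A) : T.reduce ≤ T := by
  classical
  induction T using LTree.induction with
  | h b s ih =>
    rw [le_iff]
    refine ⟨fun h => by simpa using h, fun a S hS => ?_⟩
    have hfin : {S | ∃ R, (a, R) ∈ (mk b s).children ∧ R.reduce = S}.Finite := by
      refine (((mk b s).children.image fun p => p.2.reduce).finite_toSet).subset ?_
      rintro _ ⟨R, hR, rfl⟩
      exact Finset.mem_coe.2 (Finset.mem_image.2 ⟨(a, R), hR, rfl⟩)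
    obtain ⟨M, hle, hM⟩ := hfin.exists_le_minimal
      (show S.reduce ∈ {S | ∃ R, (a, R) ∈ (mk b s).children ∧ R.reduce = S} from ⟨S, hS, rfl⟩)
    exact ⟨M, mem_children_reduce.2 hM, hle.trans (ih a S (by simpa using hS))⟩

theorem ext_children {T S : LTree A} (hb : T.rootIsPoint = S.rootIsPoint)
    (hc : ∀ a R, (a, R) ∈ T.children ↔ (a, R) ∈ S.children) : T = S := by
  rw [← mk_eta T, ← mk_eta S, hb]
  congr 1
  ext ⟨a, R⟩
  exact hc a R

theorem reduce_reduce (T : LTree A) : T.reduce.reduce = T.reduce := by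
  induction T using LTree.induction with
  | h b s ih =>
    refine ext_children (by simp) fun a R => ?_
    have key : ∀ S, (∃ R, (a, R) ∈ (mk b s).reduce.children ∧ R.reduce = S) ↔
        (a, S) ∈ (mk b s).reduce.children := by
      have hfix : ∀ R, (a, R) ∈ (mk b s).reduce.children → R.reduce = R := by
        intro R hR
        obtain ⟨Q, hQ, rfl⟩ := (mem_children_reduce.1 hR).prop
        exact ih a Q (by simpa using hQ)
      exact fun S => ⟨fun ⟨R, hR, e⟩ => e ▸ (hfix R hR).symm ▸ hR, fun h => ⟨S, h, hfix S h⟩⟩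
    rw [mem_children_reduce]
    simp only [key]
    refine ⟨fun h => h.prop, fun h => ⟨h, fun S hS hle => ?_⟩⟩
    exact (mem_children_reduce.1 h).2 (mem_children_reduce.1 hS).prop hle

theorem reduce_eq_of_mem_children {T : LTree A} (hT : T.reduce = T) {a : A} {S : LTree A}
    (hS : (a, S) ∈ T.children) : S.reduce = S := by
  rw [← hT] at hS
  obtain ⟨R, -, rfl⟩ := (mem_children_reduce.1 hS).prop
  exact reduce_reduce R

theorem minimal_of_mem_children {T : LTree A} (hT : T.reduce = T) {a : A} {S : LTree A}
    (hS : (a, S) ∈ T.children) : Minimal (fun S => (a, S) ∈ T.children) S := by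
  refine ⟨hS, fun R hR hle => ?_⟩
  rw [← hT] at hS
  exact (mem_children_reduce.1 hS).2 ⟨R, hR, reduce_eq_of_mem_children hT hR⟩ hle

/-- Going from a child R of one tree to a smaller child of the other and back yields a child below
R. Minimality closes the cycle, so R is equivalent to the intermediate child, and induction makes
them equal. -/
theorem eq_of_le_of_le {T S : LTree A} (hT : T.reduce = T) (hS : S.reduce = S)
    (h₁ : T ≤ S) (h₂ : S ≤ T) : T = S := by
  induction T using LTree.induction generalizing S with
  | h b s ih =>
    have h₁' := (le_iff _ _).1 h₁
    have h₂' := (le_iff _ _).1 h₂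
    refine ext_children (Bool.eq_iff_iff.2 ⟨h₂'.1, h₁'.1⟩) fun a R => ⟨fun hR => ?_, fun hR => ?_⟩
    · obtain ⟨S', hS', hle₁⟩ := h₂'.2 a R hR
      obtain ⟨T', hT', hle₂⟩ := h₁'.2 a S' hS'
      have hle₃ := (minimal_of_mem_children hT hR).2 hT' (hle₂.trans hle₁)
      have e := ih a R (by simpa using hR) (reduce_eq_of_mem_children hT hR)
        (reduce_eq_of_mem_children hS hS') (hle₃.trans hle₂) hle₁
      exact e ▸ hS'
    · obtain ⟨T', hT', hle₁⟩ := h₁'.2 a R hR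
      obtain ⟨S', hS', hle₂⟩ := h₂'.2 a T' hT'
      have hle₃ := (minimal_of_mem_children hS hR).2 hS' (hle₂.trans hle₁)
      have e := ih a T' (by simpa using hT') (reduce_eq_of_mem_children hT hT')
        (reduce_eq_of_mem_children hS hR) hle₁ (hle₃.trans hle₂)
      exact e ▸ hT'

/-! ### Children of grafts and of trees without point -/

theorem rootIsPoint_graft (T S : LTree A) :
    (graft T S).rootIsPoint = (T.rootIsPoint && S.rootIsPoint) := by
  classical
  rw [← mk_eta T, graft, fold_mk]
  cases T.rootIsPoint <;> simp

theorem mem_children_graft {T S : LTree A} {a : A} {R : LTree A} :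
    (a, R) ∈ (graft T S).children ↔ (∃ Q, (a, Q) ∈ T.children ∧ graft Q S = R) ∨
      (T.rootIsPoint = true ∧ (a, R) ∈ S.children) := by
  classical
  rw [← mk_eta T, graft, fold_mk, children_mk, rootIsPoint_mk]
  have key : (a, R) ∈ T.children.image (fun p => (p.1, fold (fun b s =>
      if b = true then mk S.rootIsPoint (s ∪ S.children) else mk false s) p.2)) ↔
      ∃ Q, (a, Q) ∈ T.children ∧ graft Q S = R := by
    simp only [Finset.mem_image, Prod.mk.injEq, Prod.exists]
    constructor
    · rintro ⟨_, Q, hQ, rfl, rfl⟩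
      exact ⟨Q, hQ, rfl⟩
    · rintro ⟨Q, hQ, rfl⟩
      exact ⟨a, Q, hQ, rfl, rfl⟩
  cases T.rootIsPoint
  · rw [if_neg (by simp), children_mk, key]
    simp
  · rw [if_pos rfl, children_mk, Finset.mem_union, key]
    simp

@[simp] theorem rootIsPoint_forget (T : LTree A) : T.forget.rootIsPoint = false := by
  classical
  rw [← mk_eta T, forget, fold_mk, rootIsPoint_mk]

theorem mem_children_forget {T : LTree A} {a : A} {R : LTree A} :
    (a, R) ∈ T.forget.children ↔ ∃ Q, (a, Q) ∈ T.children ∧ Q.forget = R := by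
  classical
  rw [← mk_eta T, forget, fold_mk, children_mk, children_mk]
  simp only [Finset.mem_image, Prod.mk.injEq, Prod.exists]
  constructor
  · rintro ⟨_, Q, hQ, rfl, rfl⟩
    exact ⟨Q, hQ, rfl⟩
  · rintro ⟨Q, hQ, rfl⟩
    exact ⟨a, Q, hQ, rfl, rfl⟩

/-! ### Pointedness -/

theorem Unpointed.rootIsPoint_eq {T : LTree A} (h : T.Unpointed) : T.rootIsPoint = false := by
  cases h; assumption

theorem Unpointed.child {T : LTree A} (h : T.Unpointed) {a : A} {S : LTree A}
    (hS : (a, S) ∈ T.children) : S.Unpointed := by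
  cases h with | intro _ _ sub => exact sub a S hS

theorem Unpointed.not_pointed {T : LTree A} (h : T.Unpointed) : ¬ T.Pointed := by
  intro hT
  induction hT with
  | root T root _ => simp [h.rootIsPoint_eq] at root
  | child T _ a S mem _ _ ih => exact ih (h.child mem)

/-- A point in the larger tree forces a point in the smaller one. -/
theorem Unpointed.of_le {T S : LTree A} (hT : T.Unpointed) (h : T ≤ S) : S.Unpointed := by
  induction S using LTree.induction generalizing T with
  | h b s ih =>
    rw [le_iff] at h
    refine ⟨_, ?_, fun a S hS => ?_⟩
    · have := hT.rootIsPoint_eq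
      have := h.1
      grind
    · obtain ⟨T', hT', hle⟩ := h.2 a S hS
      exact ih a S (by simpa using hS) (hT.child hT') hle

theorem unpointed_forget (T : LTree A) : T.forget.Unpointed := by
  induction T using LTree.induction with
  | h b s ih =>
    refine ⟨_, by simp, fun a S hS => ?_⟩
    obtain ⟨Q, hQ, rfl⟩ := mem_children_forget.1 hS
    exact ih a Q (by simpa using hQ)

theorem Unpointed.reduce {T : LTree A} (h : T.Unpointed) : T.reduce.Unpointed :=
  h.of_le (le_reduce T)

theorem Unpointed.graft {T : LTree A} (h : T.Unpointed) (S : LTree A) :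
    (LTree.graft T S).Unpointed := by
  induction h with
  | intro T root sub ih =>
    refine ⟨_, by simp [rootIsPoint_graft, root], fun a R hR => ?_⟩
    obtain ⟨Q, hQ, rfl⟩ | ⟨h, -⟩ := mem_children_graft.1 hR
    · exact ih a Q hQ
    · simp [root] at h

/-- The child subtree containing the point survives: a sibling strictly below it would be unpointed,
and trees above unpointed ones are unpointed. -/
theorem Pointed.reduce {T : LTree A} (h : T.Pointed) : T.reduce.Pointed := by
  induction h with
  | root T root sub =>
    refine .root _ (by simpa using root) fun a S hS => ?_
    obtain ⟨R, hR, rfl⟩ := (mem_children_reduce.1 hS).prop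
    exact (sub a R hR).reduce
  | child T root a S mem pointed others ih =>
    refine .child _ (by simpa using root) a S.reduce (mem_children_reduce.2 ?_) ih ?_
    · refine ⟨⟨S, mem, rfl⟩, ?_⟩
      rintro _ ⟨R, hR, rfl⟩ hle
      by_cases e : R = S
      · exact e ▸ le_rfl
      · have hun := others a R hR (by simpa using e)
        exact absurd pointed (hun.reduce.of_le (hle.trans (reduce_le S))).not_pointed
    · intro b R hR hne
      obtain ⟨Q, hQ, rfl⟩ := (mem_children_reduce.1 hR).prop
      refine (others b Q hQ ?_).reduce
      rintro ⟨⟩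
      exact hne rfl

theorem Pointed.graft {T S : LTree A} (h : T.Pointed) (hS : S.Pointed) :
    (LTree.graft T S).Pointed := by
  induction h with
  | root T root sub =>
    cases hS with
    | root _ rootS subS =>
      refine .root _ (by simp [rootIsPoint_graft, root, rootS]) fun a R hR => ?_
      obtain ⟨Q, hQ, rfl⟩ | ⟨-, h⟩ := mem_children_graft.1 hR
      · exact (sub a Q hQ).graft S
      · exact subS a R h
    | child _ rootS a Q mem pointed others =>
      refine .child _ (by simp [rootIsPoint_graft, rootS]) a Q
        (mem_children_graft.2 (.inr ⟨root, mem⟩)) pointed fun b R hR hne => ?_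
      obtain ⟨P, hP, rfl⟩ | ⟨-, h⟩ := mem_children_graft.1 hR
      · exact (sub b P hP).graft S
      · exact others b R h hne
  | child T root a Q mem pointed others ih =>
    refine .child _ (by simp [rootIsPoint_graft, root]) a _
      (mem_children_graft.2 (.inl ⟨Q, mem, rfl⟩)) ih fun b R hR hne => ?_
    obtain ⟨P, hP, rfl⟩ | ⟨h, -⟩ := mem_children_graft.1 hR
    · refine (others b P hP ?_).graft S
      rintro ⟨⟩
      exact hne rfl
    · simp [root] at h

theorem concat_mem_reducedPointed {T S : LTree A} (hT : T.Pointed) (hS : S.Pointed) :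
    concat T S ∈ reducedPointed A :=
  ⟨(hT.graft hS).reduce, reduce_reduce _⟩

theorem domain_mem_reducedPointed (T : LTree A) : domain T ∈ reducedPointed A := by
  refine ⟨Pointed.reduce (.root _ (by simp) fun a S hS => ?_), reduce_reduce _⟩
  rw [children_mk] at hS
  exact (unpointed_forget T).child hS

/-- This is the uniqueness of the path to the point, one edge at a time. -/
theorem Pointed.child_unique {T : LTree A} (hT : T.Pointed) {a b : A} {S R : LTree A}
    (hS : (a, S) ∈ T.children) (hR : (b, R) ∈ T.children) (hSu : ¬ S.Unpointed)
    (hRu : ¬ R.Unpointed) : T.rootIsPoint = false ∧ S.Pointed ∧ a = b ∧ S = R := by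
  cases hT with
  | root _ root sub => exact absurd (sub a S hS) hSu
  | child _ root c P mem pointed others =>
    have e₁ : (a, S) = (c, P) := by_contra fun h => hSu (others a S hS h)
    have e₂ : (b, R) = (c, P) := by_contra fun h => hRu (others b R hR h)
    cases e₁
    cases e₂
    exact ⟨root, pointed, rfl, rfl⟩

theorem pointed_trivial : (trivial : LTree A).Pointed :=
  .root _ (by simp [trivial]) (by simp [trivial])

theorem trivial_mem_reducedPointed : (trivial : LTree A) ∈ reducedPointed A := by
  refine ⟨pointed_trivial, ext_children (by simp) fun a R => ?_⟩
  rw [mem_children_reduce]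
  simp [trivial, Minimal]

theorem arrow_mem_reducedPointed (a : A) : arrow a ∈ reducedPointed A := by
  refine ⟨.child _ (by simp [arrow]) a trivial (by simp [arrow]) pointed_trivial
    (by simp +contextual [arrow]), ext_children (by simp) fun b R => ?_⟩
  rw [mem_children_reduce]
  simp only [arrow, children_mk, Finset.mem_singleton, Prod.mk.injEq]
  constructor
  · intro h
    obtain ⟨Q, ⟨hb, rfl⟩, rfl⟩ := h.prop
    exact ⟨hb, trivial_mem_reducedPointed.2⟩
  · rintro ⟨rfl, rfl⟩
    refine ⟨⟨_, ⟨rfl, rfl⟩, trivial_mem_reducedPointed.2⟩, ?_⟩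
    rintro _ ⟨Q, ⟨-, rfl⟩, rfl⟩ -
    exact le_reduce _

end LTree

/-! ### Homomorphisms into the graph of a tree -/

namespace LTree

variable {A : Type u}

/-- `Maps P T S`: there is a map from `S` to the tree `T`, sending the root to the root,
children to children along edges with the same label, and points to vertices satisfying `P`. -/
inductive Maps (P : LTree A → Prop) : LTree A → LTree A → Prop
  | intro (T S : LTree A) (root : S.rootIsPoint = true → P T)
      (image : A → LTree A → LTree A)
      (mem : ∀ a S', (a, S') ∈ S.children → (a, image a S') ∈ T.children)
      (maps : ∀ a S', (a, S') ∈ S.children → Maps P (image a S') S') : Maps P T S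

theorem maps_iff {P : LTree A → Prop} {T S : LTree A} :
    Maps P T S ↔ (S.rootIsPoint = true → P T) ∧
      ∀ a S', (a, S') ∈ S.children → ∃ T', (a, T') ∈ T.children ∧ Maps P T' S' := by
  constructor
  · rintro ⟨_, _, h, f, h₁, h₂⟩
    exact ⟨h, fun a S' hS' => ⟨f a S', h₁ a S' hS', h₂ a S' hS'⟩⟩
  · rintro ⟨h₁, h₂⟩
    have : Nonempty (LTree A) := ⟨T⟩
    choose! f hf using h₂
    exact ⟨_, _, h₁, f, fun a S' hS' => (hf a S' hS').1, fun a S' hS' => (hf a S' hS').2⟩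

theorem Maps.trans_le {P : LTree A → Prop} {T S S' : LTree A} (h : Maps P T S) (hle : S ≤ S') :
    Maps P T S' := by
  induction S' using LTree.induction generalizing T S with
  | h b s ih =>
    rw [maps_iff] at h ⊢
    rw [le_iff] at hle
    refine ⟨fun hb => h.1 (hle.1 hb), fun a R hR => ?_⟩
    obtain ⟨Q, hQ, hQR⟩ := hle.2 a R hR
    obtain ⟨T', hT', hm⟩ := h.2 a Q hQ
    exact ⟨T', hT', ih a R (by simpa using hR) hm hQR⟩

theorem Maps.le {P : LTree A → Prop} (hP : ∀ T, P T → T.rootIsPoint = true) {T S : LTree A}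
    (h : Maps P T S) : T ≤ S := by
  induction S using LTree.induction generalizing T with
  | h b s ih =>
    rw [maps_iff] at h
    rw [le_iff]
    refine ⟨fun hb => hP _ (h.1 hb), fun a R hR => ?_⟩
    obtain ⟨T', hT', hm⟩ := h.2 a R hR
    exact ⟨T', hT', ih a R (by simpa using hR) hm⟩

/-- Without points the condition on their images is vacuous, so it may be replaced by any other. -/
theorem Maps.forget {P P' : LTree A → Prop} {T S : LTree A} (h : Maps P T S) :
    Maps P' T S.forget := by
  induction S using LTree.induction generalizing T with
  | h b s ih =>
    rw [maps_iff] at h ⊢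
    refine ⟨by simp, fun a R hR => ?_⟩
    obtain ⟨Q, hQ, rfl⟩ := mem_children_forget.1 hR
    obtain ⟨T', hT', hm⟩ := h.2 a Q hQ
    exact ⟨T', hT', ih a Q (by simpa using hQ) hm⟩

/-- The two maps glue because points of `S₁` go exactly to `Z`, where the map on `S₂` starts. -/
theorem Maps.graft {P : LTree A → Prop} {T Z S₁ S₂ : LTree A} (h₁ : Maps (· = Z) T S₁)
    (h₂ : Maps P Z S₂) : Maps P T (LTree.graft S₁ S₂) := by
  induction S₁ using LTree.induction generalizing T with
  | h b s ih =>
    rw [maps_iff] at h₁ ⊢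
    rw [maps_iff] at h₂
    refine ⟨fun hb => ?_, fun a R hR => ?_⟩
    · rw [rootIsPoint_graft, Bool.and_eq_true] at hb
      rw [h₁.1 hb.1]
      exact h₂.1 hb.2
    · obtain ⟨Q, hQ, rfl⟩ | ⟨hb, hR⟩ := mem_children_graft.1 hR
      · obtain ⟨T', hT', hm⟩ := h₁.2 a Q hQ
        exact ⟨T', hT', ih a Q (by simpa using hQ) hm⟩
      · rw [h₁.1 hb]
        exact h₂.2 a R hR

theorem mk_le_of_children_subset {b : Bool} {s : Finset (A × LTree A)} {S : LTree A}
    (hb : S.rootIsPoint = true → b = true) (hs : S.children ⊆ s) : mk b s ≤ S := by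
  rw [le_iff]
  exact ⟨fun h => by simpa using hb h, fun a R hR => ⟨R, by simpa using hs hR, le_rfl⟩⟩

theorem graft_le {T S : LTree A} (hT : T.rootIsPoint = true) : graft T S ≤ S := by
  rw [le_iff]
  exact ⟨fun h => by simp [rootIsPoint_graft, hT, h],
    fun a R hR => ⟨R, mem_children_graft.2 (.inr ⟨hT, hR⟩), le_rfl⟩⟩

end LTree

/-! ### Relational semantics and its agreement with the tree interpretation -/

namespace KADTerm

open Relation LTree

variable {A : Type u}

/-- The relational interpretation of a term in the graph whose vertices are the trees and whose
`a`-labelled edges lead from a tree to the child subtrees of its root with label `a`. -/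
def rel : KADTerm A → LTree A → LTree A → Prop
  | .var a => fun x y => (a, y) ∈ x.children
  | .zero => fun _ _ => False
  | .one => fun x y => x = y
  | .add s t => fun x y => s.rel x y ∨ t.rel x y
  | .comp s t => fun x y => ∃ z, s.rel x z ∧ t.rel z y
  | .star s => ReflTransGen s.rel
  | .dom s => fun x y => x = y ∧ ∃ z, s.rel x z

/-- The pair of root and point of `T` is in the relational interpretation of `t`. -/
def Sat (t : KADTerm A) (T : LTree A) : Prop := ∃ y, y.rootIsPoint = true ∧ t.rel T y

/-- The order is a simulation: each edge out of the larger tree is matched from the smaller one, and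
tests, being positive, stay true. -/
theorem rel_of_le (t : KADTerm A) {T S y : LTree A} (hle : T ≤ S) (h : t.rel S y) :
    ∃ y', y' ≤ y ∧ t.rel T y' := by
  induction t generalizing T S y with
  | var a =>
    obtain ⟨y', hy', hle'⟩ := ((le_iff _ _).1 hle).2 a y h
    exact ⟨y', hle', hy'⟩
  | zero => exact h.elim
  | one => exact ⟨T, (show S = y from h) ▸ hle, rfl⟩
  | add s t ihs iht =>
    rcases h with h | h
    · obtain ⟨y', h₁, h₂⟩ := ihs hle h
      exact ⟨y', h₁, .inl h₂⟩
    · obtain ⟨y', h₁, h₂⟩ := iht hle h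
      exact ⟨y', h₁, .inr h₂⟩
  | comp s t ihs iht =>
    obtain ⟨z, hz, hy⟩ := h
    obtain ⟨z', hz₁, hz₂⟩ := ihs hle hz
    obtain ⟨y', hy₁, hy₂⟩ := iht hz₁ hy
    exact ⟨y', hy₁, z', hz₂, hy₂⟩
  | star s ih =>
    change ReflTransGen s.rel S y at h
    induction h with
    | refl => exact ⟨T, hle, .refl⟩
    | tail _ h ih' =>
      obtain ⟨z', hz₁, hz₂⟩ := ih'
      obtain ⟨y', hy₁, hy₂⟩ := ih hz₁ h
      exact ⟨y', hy₁, hz₂.tail hy₂⟩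
  | dom s ih =>
    obtain ⟨rfl, z, hz⟩ := h
    obtain ⟨z', -, hz'⟩ := ih hle hz
    exact ⟨T, hle, rfl, z', hz'⟩

theorem Sat.of_le {t : KADTerm A} {T S : LTree A} (h : t.Sat S) (hle : T ≤ S) : t.Sat T := by
  obtain ⟨y, hy, hr⟩ := h
  obtain ⟨y', hle', hr'⟩ := t.rel_of_le hle hr
  exact ⟨y', ((le_iff _ _).1 hle').1 hy, hr'⟩

/-- Terms are built positively from edges. The maps of interest are `forget` and grafting a fixed
tree. -/
theorem rel_map (t : KADTerm A) {f : LTree A → LTree A}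
    (hf : ∀ a x y, (a, y) ∈ x.children → (a, f y) ∈ (f x).children) {x y : LTree A}
    (h : t.rel x y) : t.rel (f x) (f y) := by
  induction t generalizing x y with
  | var a => exact hf a x y h
  | zero => exact h
  | one => exact congrArg f h
  | add s t ihs iht => exact h.imp ihs iht
  | comp s t ihs iht => exact h.imp' f fun z hz => ⟨ihs hz.1, iht hz.2⟩
  | star s ih => exact ReflTransGen.lift f (fun _ _ => ih) _ _ h
  | dom s ih => exact ⟨congrArg f h.1, h.2.imp' f fun z => ih⟩

/-- Grafting carries the run of `s` to one ending at `graft y S₂`. As `y` is a point, this tree lies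
below `S₂`, so the run of `t` continues from there. -/
theorem sat_comp_concat {s t : KADTerm A} {S₁ S₂ : LTree A} (h₁ : s.Sat S₁) (h₂ : t.Sat S₂) :
    (s.comp t).Sat (concat S₁ S₂) := by
  refine Sat.of_le (S := graft S₁ S₂) ?_ (reduce_le _)
  obtain ⟨y, hy, hr⟩ := h₁
  obtain ⟨z, hz, hr'⟩ := h₂.of_le (graft_le (S := S₂) hy)
  refine ⟨z, hz, graft y S₂, ?_, hr'⟩
  exact s.rel_map (f := fun x => graft x S₂)
    (fun a x y h => mem_children_graft.2 (.inl ⟨y, h, rfl⟩)) hr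

theorem sat_of_mem_interp {t : KADTerm A} {S : LTree A} (h : S ∈ t.interp) : t.Sat S := by
  induction t generalizing S with
  | var a =>
    obtain rfl : S = arrow a := h
    exact ⟨LTree.trivial, by simp [LTree.trivial], by simp [rel, arrow]⟩
  | zero => exact h.elim
  | one =>
    obtain rfl : S = LTree.trivial := h
    exact ⟨LTree.trivial, by simp [LTree.trivial], rfl⟩
  | add s t ihs iht =>
    obtain h | h := h.prop
    · exact (ihs h).imp fun y hy => ⟨hy.1, .inl hy.2⟩
    · exact (iht h).imp fun y hy => ⟨hy.1, .inr hy.2⟩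
  | comp s t ihs iht =>
    obtain ⟨S₁, h₁, S₂, h₂, rfl⟩ := h.prop
    exact sat_comp_concat (ihs h₁) (iht h₂)
  | star s ih =>
    obtain ⟨n, hn⟩ := Set.mem_iUnion.1 h.prop
    clear h
    induction n generalizing S with
    | zero =>
      obtain rfl : S = LTree.trivial := hn
      exact ⟨LTree.trivial, by simp [LTree.trivial], .refl⟩
    | succ n ihn =>
      obtain ⟨S₁, h₁, S₂, h₂, rfl⟩ := hn
      obtain ⟨y, hy, z, hz, hzy⟩ := sat_comp_concat (ihn h₁) (ih h₂)
      exact ⟨y, hy, ReflTransGen.tail hz hzy⟩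
  | dom s ih =>
    obtain ⟨S₁, h₁, rfl⟩ := h.prop
    refine Sat.of_le ?_ (reduce_le _)
    obtain ⟨y, -, hr⟩ := ih h₁
    -- Forgetting the point preserves the run, and marking the root afterwards only moves down in
    -- the order.
    have hr' := s.rel_map (f := forget) (fun a x y h => mem_children_forget.2 ⟨y, h, rfl⟩) hr
    obtain ⟨z, -, hz⟩ := s.rel_of_le
      (mk_le_of_children_subset (b := true) (fun _ => rfl) (Finset.Subset.refl _)) hr'
    exact ⟨_, rootIsPoint_mk _ _, rfl, z, hz⟩

/-- The tree records the edges of the run and of its tests. The endpoint `y` need not be a point: in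
a composition the intermediate vertex is arbitrary, and the maps are glued there. -/
theorem exists_maps_of_rel {t : KADTerm A} {x y : LTree A} (h : t.rel x y) :
    ∃ S ∈ t.interp, Maps (· = y) x S := by
  have up : ∀ {K : Set (LTree A)} {x y S : LTree A}, S ∈ K → Maps (· = y) x S →
      ∃ S ∈ maximal K, Maps (· = y) x S := by
    intro K x y S hS hm
    obtain ⟨S', hS', hle⟩ := exists_le_mem_maximal hS
    exact ⟨S', hS', hm.trans_le hle⟩
  have triv : ∀ x : LTree A, Maps (· = x) x LTree.trivial := fun x =>
    maps_iff.2 ⟨fun _ => rfl, by simp [LTree.trivial]⟩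
  induction t generalizing x y with
  | var a =>
    refine ⟨_, rfl, maps_iff.2 ⟨by simp [arrow], ?_⟩⟩
    simp only [arrow, children_mk, Finset.mem_singleton, Prod.mk.injEq]
    rintro _ _ ⟨rfl, rfl⟩
    exact ⟨y, h, triv y⟩
  | zero => exact h.elim
  | one =>
    obtain rfl : x = y := h
    exact ⟨_, rfl, triv x⟩
  | add s t ihs iht =>
    rcases h with h | h
    · obtain ⟨S, hS, hm⟩ := ihs h
      exact up (.inl hS) hm
    · obtain ⟨S, hS, hm⟩ := iht h
      exact up (.inr hS) hm
  | comp s t ihs iht =>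
    obtain ⟨z, hz, hy⟩ := h
    obtain ⟨S₁, h₁, m₁⟩ := ihs hz
    obtain ⟨S₂, h₂, m₂⟩ := iht hy
    exact up ⟨S₁, h₁, S₂, h₂, rfl⟩ ((m₁.graft m₂).trans_le (le_reduce _))
  | star s ih =>
    -- Powers are formed without `maximal`, so the induction stays among them and passes to a
    -- maximal tree once, at the end.
    suffices H : ∃ n, ∃ S ∈ setPow s.interp n, Maps (· = y) x S by
      obtain ⟨n, S, hS, hm⟩ := H
      exact up (Set.mem_iUnion.2 ⟨n, hS⟩) hm
    change ReflTransGen s.rel x y at h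
    induction h with
    | refl => exact ⟨0, _, rfl, triv x⟩
    | tail _ h ih' =>
      obtain ⟨n, S₁, h₁, m₁⟩ := ih'
      obtain ⟨S₂, h₂, m₂⟩ := ih h
      exact ⟨n + 1, _, ⟨S₁, h₁, S₂, h₂, rfl⟩, (m₁.graft m₂).trans_le (le_reduce _)⟩
  | dom s ih =>
    obtain ⟨rfl, z, hz⟩ := h
    obtain ⟨S, hS, hm⟩ := ih hz
    refine up ⟨S, hS, rfl⟩ (Maps.trans_le (maps_iff.2 ⟨fun _ => rfl, ?_⟩) (le_reduce _))
    rw [children_mk]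
    exact (maps_iff.1 hm.forget).2

theorem interp_subset_reducedPointed (t : KADTerm A) : t.interp ⊆ reducedPointed A := by
  induction t with
  | var a => rintro _ rfl; exact arrow_mem_reducedPointed a
  | zero => exact Set.empty_subset _
  | one => rintro _ rfl; exact trivial_mem_reducedPointed
  | add s t ihs iht => exact fun S hS => hS.prop.elim (@ihs S) (@iht S)
  | comp s t ihs iht =>
    intro S hS
    obtain ⟨S₁, h₁, S₂, h₂, rfl⟩ := hS.prop
    exact concat_mem_reducedPointed (ihs h₁).1 (iht h₂).1
  | star s ih =>
    intro S hS
    obtain ⟨n, hn⟩ := Set.mem_iUnion.1 hS.prop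
    clear hS
    induction n generalizing S with
    | zero => obtain rfl : S = LTree.trivial := hn; exact trivial_mem_reducedPointed
    | succ n ihn =>
      obtain ⟨S₁, h₁, S₂, h₂, rfl⟩ := hn
      exact concat_mem_reducedPointed (ihn h₁).1 (ih h₂).1
  | dom s ih =>
    intro S hS
    obtain ⟨S₁, h₁, rfl⟩ := hS.prop
    exact domain_mem_reducedPointed S₁

theorem mem_down_interp {t : KADTerm A} {T : LTree A} :
    T ∈ down t.interp ↔ T ∈ reducedPointed A ∧ t.Sat T := by
  refine and_congr_right fun _ => ⟨fun ⟨S, hS, hle⟩ => (sat_of_mem_interp hS).of_le hle, ?_⟩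
  rintro ⟨y, hy, hr⟩
  obtain ⟨S, hS, hm⟩ := exists_maps_of_rel hr
  exact ⟨S, hS, hm.le (by rintro _ rfl; exact hy)⟩

/-- Interpretations are antichains, by maximality or because they have at most one element. -/
theorem le_of_mem_interp {t : KADTerm A} {T S : LTree A} (hT : T ∈ t.interp) (hS : S ∈ t.interp)
    (hle : T ≤ S) : S ≤ T := by
  cases t with
  | var a =>
    obtain rfl : T = arrow a := hT
    obtain rfl : S = arrow a := hS
    exact le_rfl
  | zero => exact hT.elim
  | one =>
    obtain rfl : T = LTree.trivial := hT
    obtain rfl : S = LTree.trivial := hS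
    exact le_rfl
  | add s t => exact hT.2 hS.prop hle
  | comp s t => exact hT.2 hS.prop hle
  | star s => exact hT.2 hS.prop hle
  | dom s => exact hT.2 hS.prop hle

/-- A regular set is recovered from its downward closure, so regular sets may be compared through
`Sat`. -/
theorem maximal_down_interp (t : KADTerm A) : maximal (down t.interp) = t.interp := by
  have sub := t.interp_subset_reducedPointed
  ext T
  constructor
  · intro hT
    obtain ⟨hTr, S, hS, hle⟩ := hT.prop
    have hle' := hT.2 (show S ∈ down t.interp from ⟨sub hS, S, hS, le_rfl⟩) hle
    exact eq_of_le_of_le hTr.2 (sub hS).2 hle hle' ▸ hS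
  · intro hT
    refine ⟨⟨sub hT, T, hT, le_rfl⟩, ?_⟩
    rintro R ⟨-, S, hS, hRS⟩ hTR
    exact hRS.trans (le_of_mem_interp hT hS (hTR.trans hRS))

end KADTerm

namespace KADTerm

open Relation LTree

variable {A : Type u}

/-! ### Finite sums and Kleene elimination -/

theorem exists_rel_iff_exists {ι : Type*} [Finite ι] (u : ι → KADTerm A) :
    ∃ t : KADTerm A, ∀ x y, t.rel x y ↔ ∃ i, (u i).rel x y := by
  classical
  have := Fintype.ofFinite ι
  suffices H : ∀ s : Finset ι, ∃ t : KADTerm A, ∀ x y, t.rel x y ↔ ∃ i ∈ s, (u i).rel x y by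
    simpa using H Finset.univ
  intro s
  induction s using Finset.induction_on with
  | empty => exact ⟨.zero, by simp [rel]⟩
  | insert i s _ ih =>
    obtain ⟨t, ht⟩ := ih
    exact ⟨.add (u i) t, fun x y => by simp [rel, ht]⟩

/-- The step relation on configurations of a transition system with states `Q` on the graph of
trees. -/
def Step {Q : Type*} (δ : Q → Q → LTree A → LTree A → Prop) (c d : Q × LTree A) : Prop :=
  δ c.1 d.1 c.2 d.2

/-- Nonempty runs whose intermediate states are in `s`. -/
inductive Via {Q : Type*} (δ : Q → Q → LTree A → LTree A → Prop) (s : Set Q) :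
    Q × LTree A → Q × LTree A → Prop
  | single {c d} (h : Step δ c d) : Via δ s c d
  | cons {c d e} (h : Step δ c d) (hd : d.1 ∈ s) (h' : Via δ s d e) : Via δ s c e

section Via

variable {Q : Type*} {δ : Q → Q → LTree A → LTree A → Prop} {s s' : Set Q}

theorem Via.mono (hs : s ⊆ s') {c d : Q × LTree A} (h : Via δ s c d) : Via δ s' c d := by
  induction h with
  | single h => exact .single h
  | cons h hd _ ih => exact .cons h (hs hd) ih

theorem Via.trans {c d e : Q × LTree A} (h : Via δ s c d) (hd : d.1 ∈ s) (h' : Via δ s d e) :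
    Via δ s c e := by
  induction h with
  | single h => exact .cons h hd h'
  | cons h hd' _ ih => exact .cons h hd' (ih hd h')

/-- The run is cut at its first and last visits to `r`; between them it is a sequence of loops at
`r` that otherwise stay in `s`. -/
theorem via_insert {r : Q} {c d : Q × LTree A} :
    Via δ (insert r s) c d ↔ Via δ s c d ∨ ∃ x, Via δ s c (r, x) ∧
      ∃ y, ReflTransGen (fun x y => Via δ s (r, x) (r, y)) x y ∧ Via δ s (r, y) d := by
  constructor
  · intro h
    induction h with
    | single h => exact .inl (.single h)
    | @cons c d e h hd _ ih =>
      obtain rfl | hd := hd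
      · right
        obtain ih | ⟨x, h₁, y, h₂, h₃⟩ := ih
        · exact ⟨d.2, .single h, d.2, .refl, ih⟩
        · exact ⟨d.2, .single h, y, .head h₁ h₂, h₃⟩
      · obtain ih | ⟨x, h₁, y, h₂, h₃⟩ := ih
        · exact .inl (.cons h hd ih)
        · exact .inr ⟨x, .cons h hd h₁, y, h₂, h₃⟩
  · have hsub := Set.subset_insert r s
    have hr : r ∈ insert r s := Set.mem_insert r s
    rintro (h | ⟨x, h₁, y, h₂, h₃⟩)
    · exact h.mono hsub
    · refine Via.trans (d := (r, y)) ?_ hr (h₃.mono hsub)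
      clear h₃
      induction h₂ with
      | refl => exact h₁.mono hsub
      | tail _ h ih => exact Via.trans ih hr (h.mono hsub)

theorem reflTransGen_step_iff_via {c d : Q × LTree A} :
    ReflTransGen (Step δ) c d ↔ c = d ∨ Via δ Set.univ c d := by
  constructor
  · intro h
    induction h using ReflTransGen.head_induction_on with
    | refl => exact .inl rfl
    | head h _ ih =>
      obtain rfl | ih := ih
      · exact .inr (.single h)
      · exact .inr (.cons h (Set.mem_univ _) ih)
  · rintro (rfl | h)
    · exact .refl
    · induction h with
      | single h => exact .single h
      | cons h _ _ ih => exact .head h ih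

theorem exists_rel_iff_via [Finite Q] {M : Q → Q → KADTerm A}
    (hM : ∀ p q x y, (M p q).rel x y ↔ δ p q x y) (s : Set Q) :
    ∃ N : Q → Q → KADTerm A, ∀ p q x y, (N p q).rel x y ↔ Via δ s (p, x) (q, y) := by
  induction s, s.toFinite using Set.Finite.induction_on with
  | empty =>
    refine ⟨M, fun p q x y => (hM p q x y).trans ⟨fun h => .single h, fun h => ?_⟩⟩
    cases h with
    | single h => exact h
    | cons _ hd _ => exact hd.elim
  | @insert r s _ _ ih =>
    obtain ⟨N, hN⟩ := ih
    refine ⟨fun p q => .add (N p q) (.comp (N p r) (.comp (.star (N r r)) (N r q))),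
      fun p q x y => ?_⟩
    have e : (N r r).rel = fun x y => Via δ s (r, x) (r, y) := by
      funext x y; exact propext (hN r r x y)
    rw [via_insert]
    simp only [rel, hN, e]

theorem exists_rel_iff_reflTransGen [Finite Q] {M : Q → Q → KADTerm A}
    (hM : ∀ p q x y, (M p q).rel x y ↔ δ p q x y) (p q : Q) :
    ∃ t : KADTerm A, ∀ x y, t.rel x y ↔ ReflTransGen (Step δ) (p, x) (q, y) := by
  classical
  obtain ⟨N, hN⟩ := exists_rel_iff_via hM Set.univ
  -- `Via` has only nonempty runs, so the empty run on the diagonal is supplied by `one`.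
  by_cases e : p = q
  · subst e
    refine ⟨.add .one (N p p), fun x y => ?_⟩
    simp [reflTransGen_step_iff_via, rel, hN]
  · refine ⟨N p q, fun x y => ?_⟩
    simp [reflTransGen_step_iff_via, hN, e]

end Via

theorem reflTransGen_step_map {Q Q' : Type*} {δ : Q → Q → LTree A → LTree A → Prop}
    {δ' : Q' → Q' → LTree A → LTree A → Prop} {f : Q → Q'}
    (hf : ∀ p q x y, δ p q x y → δ' (f p) (f q) x y) {p q : Q} {x y : LTree A}
    (h : ReflTransGen (Step δ) (p, x) (q, y)) : ReflTransGen (Step δ') (f p, x) (f q, y) :=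
  ReflTransGen.lift (fun c : Q × LTree A => (f c.1, c.2)) (fun _ _ h => hf _ _ _ _ h) _ _ h

/-! ### Automata with tests -/

/-- A relation that consists of the test `u` and the edges with labels in `F`. -/
def IsTransition (r : LTree A → LTree A → Prop) : Prop :=
  ∃ (u : KADTerm A) (F : Finset A), ∀ x y,
    r x y ↔ (x = y ∧ ∃ z, u.rel x z) ∨ ∃ a ∈ F, (a, y) ∈ x.children

theorem IsTransition.exists_rel {r : LTree A → LTree A → Prop} (h : IsTransition r) :
    ∃ t : KADTerm A, ∀ x y, t.rel x y ↔ r x y := by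
  obtain ⟨u, F, h⟩ := h
  obtain ⟨v, hv⟩ := exists_rel_iff_exists fun a : F => var a.1
  exact ⟨.add (.dom u) v, fun x y => by simp [rel, hv, h]⟩

theorem isTransition_false : IsTransition fun _ _ : LTree A => False :=
  ⟨.zero, ∅, by simp [rel]⟩

/-- Silent moves are tests of `one`; they link automata in `Recognizable.comp` and
`Recognizable.star`. -/
theorem isTransition_eq (p : Prop) : IsTransition fun x y : LTree A => p ∧ x = y := by
  by_cases hp : p
  · exact ⟨.one, ∅, by simp [rel, hp]⟩
  · simpa only [hp, false_and] using isTransition_false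

/-- Relations recognized by finite automata with tests. -/
def Recognizable (r : LTree A → LTree A → Prop) : Prop :=
  ∃ (Q : Type) (_ : Finite Q) (δ : Q → Q → LTree A → LTree A → Prop) (I F : Set Q),
    (∀ p q, IsTransition (δ p q)) ∧
    ∀ x y, r x y ↔ ∃ p ∈ I, ∃ q ∈ F, ReflTransGen (Step δ) (p, x) (q, y)

theorem Recognizable.exists_rel {r : LTree A → LTree A → Prop} (h : Recognizable r) :
    ∃ t : KADTerm A, ∀ x y, t.rel x y ↔ r x y := by
  obtain ⟨Q, _, δ, I, F, hδ, h⟩ := h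
  choose M hM using fun p q => (hδ p q).exists_rel
  choose N hN using exists_rel_iff_reflTransGen hM
  obtain ⟨t, ht⟩ := exists_rel_iff_exists fun c : I × F => N c.1 c.2
  refine ⟨t, fun x y => ?_⟩
  simp [ht, h, hN]

theorem recognizable_of_isTransition {r : LTree A → LTree A → Prop} (h : IsTransition r) :
    Recognizable r := by
  refine ⟨Bool, inferInstance, fun p q x y => p = false ∧ q = true ∧ r x y, {false}, {true},
    fun p q => ?_, fun x y => ?_⟩
  · cases p <;> cases q <;> simp [isTransition_false, h]
  · simp only [Set.mem_singleton_iff, exists_eq_left]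
    constructor
    · exact fun h => .single ⟨rfl, rfl, h⟩
    · intro h
      obtain h | ⟨⟨b, z⟩, ⟨-, e, h⟩, h'⟩ := h.cases_head
      · cases h
      · obtain rfl : b = true := e
        obtain h' | ⟨_, ⟨e, -⟩, _⟩ := h'.cases_head
        · cases h'; exact h
        · cases e

theorem Recognizable.sup {r₁ r₂ : LTree A → LTree A → Prop} (h₁ : Recognizable r₁)
    (h₂ : Recognizable r₂) : Recognizable fun x y => r₁ x y ∨ r₂ x y := by
  obtain ⟨Q₁, _, δ₁, I₁, F₁, hδ₁, h₁⟩ := h₁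
  obtain ⟨Q₂, _, δ₂, I₂, F₂, hδ₂, h₂⟩ := h₂
  let δ : Q₁ ⊕ Q₂ → Q₁ ⊕ Q₂ → LTree A → LTree A → Prop
    | .inl p, .inl q => δ₁ p q
    | .inr p, .inr q => δ₂ p q
    | _, _ => fun _ _ => False
  refine ⟨Q₁ ⊕ Q₂, inferInstance, δ, {p | Sum.elim (· ∈ I₁) (· ∈ I₂) p},
    {p | Sum.elim (· ∈ F₁) (· ∈ F₂) p}, ?_, fun x y => ?_⟩
  · rintro (p | p) (q | q)
    exacts [hδ₁ p q, isTransition_false, isTransition_false, hδ₂ p q]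
  have e₁ : ∀ p c, ReflTransGen (Step δ) (.inl p, x) c → ∃ q,
      c.1 = .inl q ∧ ReflTransGen (Step δ₁) (p, x) (q, c.2) := by
    intro p c h
    induction h with
    | refl => exact ⟨p, rfl, .refl⟩
    | @tail c d _ h ih =>
      obtain ⟨q, e, hq⟩ := ih
      obtain ⟨_, z⟩ := c
      obtain ⟨q' | q', z'⟩ := d
      · cases e; exact ⟨q', rfl, hq.tail h⟩
      · cases e; exact h.elim
  have e₂ : ∀ p c, ReflTransGen (Step δ) (.inr p, x) c → ∃ q,
      c.1 = .inr q ∧ ReflTransGen (Step δ₂) (p, x) (q, c.2) := by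
    intro p c h
    induction h with
    | refl => exact ⟨p, rfl, .refl⟩
    | @tail c d _ h ih =>
      obtain ⟨q, e, hq⟩ := ih
      obtain ⟨_, z⟩ := c
      obtain ⟨q' | q', z'⟩ := d
      · cases e; exact h.elim
      · cases e; exact ⟨q', rfl, hq.tail h⟩
  simp only [h₁, h₂]
  constructor
  · rintro (⟨p, hp, q, hq, h⟩ | ⟨p, hp, q, hq, h⟩)
    · exact ⟨.inl p, hp, .inl q, hq,
        reflTransGen_step_map (f := Sum.inl) (fun _ _ _ _ h => h) h⟩
    · exact ⟨.inr p, hp, .inr q, hq,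
        reflTransGen_step_map (f := Sum.inr) (fun _ _ _ _ h => h) h⟩
  · rintro ⟨p | p, hp, q, hq, h⟩
    · obtain ⟨q', e, h'⟩ := e₁ p _ h
      obtain rfl : q = .inl q' := e
      exact .inl ⟨p, hp, q', hq, h'⟩
    · obtain ⟨q', e, h'⟩ := e₂ p _ h
      obtain rfl : q = .inr q' := e
      exact .inr ⟨p, hp, q', hq, h'⟩

theorem Recognizable.comp {r₁ r₂ : LTree A → LTree A → Prop} (h₁ : Recognizable r₁)
    (h₂ : Recognizable r₂) : Recognizable fun x y => ∃ z, r₁ x z ∧ r₂ z y := by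
  obtain ⟨Q₁, _, δ₁, I₁, F₁, hδ₁, h₁⟩ := h₁
  obtain ⟨Q₂, _, δ₂, I₂, F₂, hδ₂, h₂⟩ := h₂
  let δ : Q₁ ⊕ Q₂ → Q₁ ⊕ Q₂ → LTree A → LTree A → Prop
    | .inl p, .inl q => δ₁ p q
    | .inr p, .inr q => δ₂ p q
    | .inl p, .inr q => fun x y => (p ∈ F₁ ∧ q ∈ I₂) ∧ x = y
    | .inr _, .inl _ => fun _ _ => False
  refine ⟨Q₁ ⊕ Q₂, inferInstance, δ, {p | Sum.elim (· ∈ I₁) (fun _ => False) p},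
    {p | Sum.elim (fun _ => False) (· ∈ F₂) p}, ?_, fun x y => ?_⟩
  · rintro (p | p) (q | q)
    exacts [hδ₁ p q, isTransition_eq _, isTransition_false, hδ₂ p q]
  -- Invariant: a run in the second component splits at its single silent crossing.
  have key : ∀ p c, ReflTransGen (Step δ) (.inl p, x) c →
      match c with
      | (.inl q, z) => ReflTransGen (Step δ₁) (p, x) (q, z)
      | (.inr q, z) => ∃ y, ∃ f ∈ F₁, ∃ i ∈ I₂,
          ReflTransGen (Step δ₁) (p, x) (f, y) ∧ ReflTransGen (Step δ₂) (i, y) (q, z) := by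
    intro p c h
    induction h with
    | refl => exact .refl
    | @tail c d _ h ih =>
      obtain ⟨q | q, z⟩ := c <;> obtain ⟨q' | q', z'⟩ := d
      · exact ReflTransGen.tail ih h
      · obtain ⟨⟨hq, hq'⟩, e⟩ := h
        cases e
        exact ⟨z, q, hq, q', hq', ih, .refl⟩
      · exact h.elim
      · obtain ⟨y, f, hf, i, hi, h₁, h₂⟩ := ih
        exact ⟨y, f, hf, i, hi, h₁, h₂.tail h⟩
  simp only [h₁, h₂]
  constructor
  · rintro ⟨z, ⟨p, hp, f, hf, h⟩, ⟨i, hi, q, hq, h'⟩⟩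
    refine ⟨.inl p, hp, .inr q, hq, ReflTransGen.trans (b := (.inl f, z)) ?_
      (ReflTransGen.head (a := (Sum.inl f, z)) (b := (Sum.inr i, z)) ⟨⟨hf, hi⟩, rfl⟩ ?_)⟩
    · exact reflTransGen_step_map (f := Sum.inl) (fun _ _ _ _ h => h) h
    · exact reflTransGen_step_map (f := Sum.inr) (fun _ _ _ _ h => h) h'
  · rintro ⟨p | p, hp, q | q, hq, h⟩
    · exact hq.elim
    · obtain ⟨z, f, hf, i, hi, h, h'⟩ := key p _ h
      exact ⟨z, ⟨p, hp, f, hf, h⟩, i, hi, q, hq, h'⟩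
    · exact hp.elim
    · exact hp.elim

/-- A fresh state `none` is both initial and final: the empty run is accepted, and each return to it
completes one factor. -/
theorem Recognizable.star {r : LTree A → LTree A → Prop} (h : Recognizable r) :
    Recognizable (ReflTransGen r) := by
  obtain ⟨Q, _, δ', I, F, hδ, h⟩ := h
  let δ : Option Q → Option Q → LTree A → LTree A → Prop
    | some p, some q => δ' p q
    | none, some q => fun x y => q ∈ I ∧ x = y
    | some p, none => fun x y => p ∈ F ∧ x = y
    | none, none => fun _ _ => False
  refine ⟨Option Q, inferInstance, δ, {none}, {none}, ?_, fun x y => ?_⟩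
  · rintro (_ | p) (_ | q)
    exacts [isTransition_false, isTransition_eq _, isTransition_eq _, hδ p q]
  have key : ∀ c, ReflTransGen (Step δ) (none, x) c →
      match c with
      | (none, z) => ReflTransGen r x z
      | (some q, z) => ∃ y, ReflTransGen r x y ∧ ∃ i ∈ I,
          ReflTransGen (Step δ') (i, y) (q, z) := by
    intro c hc
    induction hc with
    | refl => exact .refl
    | @tail c d _ hs ih =>
      obtain ⟨_ | q, z⟩ := c <;> obtain ⟨_ | q', z'⟩ := d
      · exact hs.elim
      · obtain ⟨hq', e⟩ := hs
        cases e
        exact ⟨z, ih, q', hq', .refl⟩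
      · obtain ⟨y, hy, i, hi, hr⟩ := ih
        obtain ⟨hq, e⟩ := hs
        cases e
        exact ReflTransGen.tail hy ((h _ _).2 ⟨i, hi, q, hq, hr⟩)
      · obtain ⟨y, hy, i, hi, hr⟩ := ih
        exact ⟨y, hy, i, hi, hr.tail hs⟩
  simp only [Set.mem_singleton_iff, exists_eq_left]
  constructor
  · intro hr
    induction hr with
    | refl => exact .refl
    | @tail y z _ hr ih =>
      obtain ⟨p, hp, q, hq, hr⟩ := (h _ _).1 hr
      refine ih.trans (ReflTransGen.head (b := (some p, y)) ⟨hp, rfl⟩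
        (ReflTransGen.tail (b := (some q, z)) ?_ ⟨hq, rfl⟩))
      exact reflTransGen_step_map (f := some) (fun _ _ _ _ h => h) hr
  · exact key _

/-- Automata may test arbitrary terms, so `dom s` is a single transition and `s` itself is not
compiled. -/
theorem recognizable_rel (t : KADTerm A) : Recognizable t.rel := by
  induction t with
  | var a => exact recognizable_of_isTransition ⟨.zero, {a}, by simp [rel]⟩
  | zero => exact recognizable_of_isTransition isTransition_false
  | one => exact recognizable_of_isTransition ⟨.one, ∅, by simp [rel]⟩
  | add s t ihs iht => exact ihs.sup iht
  | comp s t ihs iht => exact ihs.comp iht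
  | star s ih => exact ih.star
  | dom s _ => exact recognizable_of_isTransition ⟨s, ∅, by simp [rel]⟩

/-! ### Intersection -/

theorem IsTransition.unpointed {r : LTree A → LTree A → Prop} (h : IsTransition r)
    {x y : LTree A} (hr : r x y) (hx : x.Unpointed) : y.Unpointed := by
  obtain ⟨u, F, h⟩ := h
  obtain ⟨rfl, -⟩ | ⟨a, -, ha⟩ := (h x y).1 hr
  · exact hx
  · exact hx.child ha

/-- Transitions stay or go down, so a run that still reaches a point starts at a subtree containing
it. -/
theorem not_unpointed_of_reflTransGen {Q : Type*} {δ : Q → Q → LTree A → LTree A → Prop}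
    (hδ : ∀ p q, IsTransition (δ p q)) {c d : Q × LTree A} (h : ReflTransGen (Step δ) c d)
    (hd : d.2.rootIsPoint = true) : ¬ c.2.Unpointed := by
  intro hc
  have H : d.2.Unpointed := by
    clear hd
    induction h with
    | refl => exact hc
    | tail _ h ih => exact (hδ _ _).unpointed h ih
  simp [H.rootIsPoint_eq] at hd

/-- Only root-to-point runs in pointed trees are compared. Elsewhere equal subtrees may be reached
along different labels, and runs with common ends need not share their edges. -/
theorem exists_sat_iff_and (t₁ t₂ : KADTerm A) :
    ∃ t : KADTerm A, ∀ T : LTree A, T.Pointed → (t.Sat T ↔ t₁.Sat T ∧ t₂.Sat T) := by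
  obtain ⟨Q₁, _, δ₁, I₁, F₁, hδ₁, h₁⟩ := recognizable_rel t₁
  obtain ⟨Q₂, _, δ₂, I₂, F₂, hδ₂, h₂⟩ := recognizable_rel t₂
  choose u₁ G₁ hG₁ using id hδ₁
  choose u₂ G₂ hG₂ using id hδ₂
  classical
  -- A test advances one component and leaves the other in place; an edge advances both and needs a
  -- label allowed by both.
  let δ : Q₁ × Q₂ → Q₁ × Q₂ → LTree A → LTree A → Prop := fun p q x y =>
    (x = y ∧ ((p.2 = q.2 ∧ ∃ z, (u₁ p.1 q.1).rel x z) ∨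
      (p.1 = q.1 ∧ ∃ z, (u₂ p.2 q.2).rel x z))) ∨
    ∃ a ∈ G₁ p.1 q.1 ∩ G₂ p.2 q.2, (a, y) ∈ x.children
  have hδ : ∀ p q, IsTransition (δ p q) := by
    intro p q
    refine ⟨.add (if p.2 = q.2 then u₁ p.1 q.1 else .zero)
      (if p.1 = q.1 then u₂ p.2 q.2 else .zero), G₁ p.1 q.1 ∩ G₂ p.2 q.2, fun x y => ?_⟩
    refine or_congr (and_congr_right fun _ => ?_) Iff.rfl
    split_ifs with e₁ e₂ e₂ <;> simp [rel, e₁, e₂, exists_or]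
  obtain ⟨t, ht⟩ := Recognizable.exists_rel (r := fun x y => ∃ p ∈ I₁ ×ˢ I₂, ∃ q ∈ F₁ ×ˢ F₂,
    ReflTransGen (Step δ) (p, x) (q, y)) ⟨Q₁ × Q₂, inferInstance, δ, _, _, hδ, fun _ _ => Iff.rfl⟩
  have proj : ∀ c d, ReflTransGen (Step δ) c d →
      ReflTransGen (Step δ₁) (c.1.1, c.2) (d.1.1, d.2) ∧
      ReflTransGen (Step δ₂) (c.1.2, c.2) (d.1.2, d.2) := by
    intro c d h
    induction h with
    | refl => exact ⟨.refl, .refl⟩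
    | @tail d e _ h ih =>
      obtain ⟨⟨p₁, p₂⟩, x⟩ := d
      obtain ⟨⟨q₁, q₂⟩, y⟩ := e
      obtain ⟨e, ⟨e', hu⟩ | ⟨e', hu⟩⟩ | ⟨a, ha, h⟩ := h
      · cases e; cases e'
        exact ⟨ih.1.tail ((hG₁ _ _ _ _).2 (.inl ⟨rfl, hu⟩)), ih.2⟩
      · cases e; cases e'
        exact ⟨ih.1, ih.2.tail ((hG₂ _ _ _ _).2 (.inl ⟨rfl, hu⟩))⟩
      · rw [Finset.mem_inter] at ha
        exact ⟨ih.1.tail ((hG₁ _ _ _ _).2 (.inr ⟨a, ha.1, h⟩)),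
          ih.2.tail ((hG₂ _ _ _ _).2 (.inr ⟨a, ha.2, h⟩))⟩
  have sat_iff : ∀ (s : KADTerm A) (T : LTree A) {Q : Type} (I F : Set Q) δ,
      (∀ x y, s.rel x y ↔ ∃ p ∈ I, ∃ q ∈ F, ReflTransGen (Step δ) (p, x) (q, y)) →
      (s.Sat T ↔ ∃ p ∈ I, ∃ q ∈ F, ∃ y, y.rootIsPoint = true ∧
        ReflTransGen (Step δ) (p, T) (q, y)) := by
    intro s T Q I F δ h
    simp only [Sat, h]
    exact ⟨fun ⟨y, hy, p, hp, q, hq, hr⟩ => ⟨p, hp, q, hq, y, hy, hr⟩,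
      fun ⟨p, hp, q, hq, y, hy, hr⟩ => ⟨y, hy, p, hp, q, hq, hr⟩⟩
  refine ⟨t, fun T hT => ?_⟩
  rw [sat_iff t T _ _ δ ht, sat_iff t₁ T _ _ δ₁ h₁, sat_iff t₂ T _ _ δ₂ h₂]
  constructor
  · rintro ⟨p, hp, q, hq, y, hy, h⟩
    have h' := proj _ _ h
    exact ⟨⟨p.1, hp.1, q.1, hq.1, y, hy, h'.1⟩, p.2, hp.2, q.2, hq.2, y, hy, h'.2⟩
  · rintro ⟨⟨p₁, hp₁, f₁, hf₁, y₁, hy₁, hr₁⟩, p₂, hp₂, f₂, hf₂, y₂, hy₂, hr₂⟩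
    -- Both runs are consumed from the front, at a common vertex. Pending tests of the first run go
    -- before those of the second, until both runs are about to take an edge.
    suffices H : ∀ c₁ : Q₁ × LTree A, ReflTransGen (Step δ₁) c₁ (f₁, y₁) → c₁.2.Pointed →
        ∀ c₂ : Q₂ × LTree A, ReflTransGen (Step δ₂) c₂ (f₂, y₂) → c₂.2 = c₁.2 →
        ∃ y, y.rootIsPoint = true ∧
          ReflTransGen (Step δ) ((c₁.1, c₂.1), c₁.2) ((f₁, f₂), y) by
      obtain ⟨y, hy, h⟩ := H _ hr₁ hT _ hr₂ rfl
      exact ⟨(p₁, p₂), ⟨hp₁, hp₂⟩, (f₁, f₂), ⟨hf₁, hf₂⟩, y, hy, h⟩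
    intro c₁ h₁
    induction h₁ using ReflTransGen.head_induction_on with
    | refl =>
      intro hx c₂ h₂
      -- The first run is over, so the common vertex is the point. The second can only have tests
      -- left, as an edge would lead into an unpointed subtree.
      induction h₂ using ReflTransGen.head_induction_on with
      | refl => exact fun _ => ⟨y₁, hy₁, .refl⟩
      | @head c d h hd ih =>
        intro hc
        obtain ⟨q, x⟩ := c
        obtain ⟨q', x'⟩ := d
        obtain rfl : x = y₁ := hc
        obtain ⟨e, hu⟩ | ⟨b, hb, hxb⟩ := (hG₂ _ _ _ _).1 h
        · obtain rfl : x = x' := e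
          obtain ⟨y, hy, hr⟩ := ih rfl
          exact ⟨y, hy, .head (b := ((f₁, q'), x)) (.inl ⟨rfl, .inr ⟨rfl, hu⟩⟩) hr⟩
        · have hn := not_unpointed_of_reflTransGen hδ₂ hd hy₂
          simp [(hx.child_unique hxb hxb hn hn).1] at hy₁
    | @head c d h hd ih =>
      obtain ⟨p, x⟩ := c
      obtain ⟨p', x'⟩ := d
      intro hx
      obtain ⟨e, hu⟩ | ⟨a, ha, hxa⟩ := (hG₁ _ _ _ _).1 h
      · obtain rfl : x = x' := e
        intro c₂ h₂ hc₂
        obtain ⟨y, hy, hr⟩ := ih hx c₂ h₂ hc₂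
        exact ⟨y, hy, .head (b := ((p', c₂.1), x)) (.inl ⟨rfl, .inl ⟨rfl, hu⟩⟩) hr⟩
      · have hn := not_unpointed_of_reflTransGen hδ₁ hd hy₁
        intro c₂ h₂
        induction h₂ using ReflTransGen.head_induction_on with
        | refl =>
          intro hc
          obtain rfl : y₂ = x := hc
          simp [(hx.child_unique hxa hxa hn hn).1] at hy₂
        | @head c e h' he ih' =>
          intro hc
          obtain ⟨q, z⟩ := c
          obtain ⟨q', z'⟩ := e
          obtain rfl : z = x := hc
          obtain ⟨e, hu⟩ | ⟨b, hb, hxb⟩ := (hG₂ _ _ _ _).1 h'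
          · obtain rfl : z = z' := e
            obtain ⟨y, hy, hr⟩ := ih' rfl
            exact ⟨y, hy, .head (b := ((p, q'), z)) (.inl ⟨rfl, .inr ⟨rfl, hu⟩⟩) hr⟩
          · have hn' := not_unpointed_of_reflTransGen hδ₂ he hy₂
            -- Both edges enter a subtree containing the point, so they are the same edge.
            obtain ⟨-, hp, e, e'⟩ := hx.child_unique hxa hxb hn hn'
            dsimp only at e e'
            subst e e'
            obtain ⟨y, hy, hr⟩ := ih hp _ he rfl
            exact ⟨y, hy, .head (.inr ⟨a, Finset.mem_inter.2 ⟨ha, hb⟩, hxa⟩) hr⟩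

end KADTerm

theorem proposition6p2 {A : Type*} (L₁ L₂ : Set (LTree A))
    (hL₁ : L₁ ⊆ LTree.reducedPointed A) (hL₂ : L₂ ⊆ LTree.reducedPointed A)
    (h₁ : LTree.IsRegular L₁) (h₂ : LTree.IsRegular L₂) :
    LTree.IsRegular (LTree.meet L₁ L₂) := by
  obtain ⟨t₁, rfl⟩ := h₁
  obtain ⟨t₂, rfl⟩ := h₂
  obtain ⟨t, ht⟩ := KADTerm.exists_sat_iff_and t₁ t₂
  refine ⟨t, ?_⟩
  -- Both sides become `maximal` of a set of reduced pointed trees, so only these sets are compared.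
  rw [← t.maximal_down_interp, LTree.meet]
  congr 1
  ext T
  simp only [Set.mem_inter_iff, KADTerm.mem_down_interp]
  constructor
  · rintro ⟨hT, h⟩
    exact ⟨⟨hT, ((ht T hT.1).1 h).1⟩, hT, ((ht T hT.1).1 h).2⟩
  · rintro ⟨⟨hT, h₁⟩, -, h₂⟩
    exact ⟨hT, (ht T hT.1).2 ⟨h₁, h₂⟩⟩
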